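/- **Setting.** Let $U$ be a separable real Banach space and $H$ a real Hilbert space with dense continuous embeddings $U\hookrightarrow H\hookrightarrow U'$, where $h\in H$ is identified with the functional $v\mapsto (h,v)_H$ on $U$. Let $T>0$, $1<r<\infty$, let $A:U\to U'$ be Borel measurable, and let $\mathbb X_1=C[0,T;U']\cap L^r[0,T;U]_{weak}$, equipped with the coarsest topology that makes the inclusions into $C[0,T;U']$ (norm topology) and into $L^r[0,T;U]$ (weak topology) continuous, and with its Borel $\sigma$-algebra. **Assumption on $A$.** If $\lambda>0$ and $u_1,u_2\in\mathbb X_1$ satisfy $A(u_1),A(u_2)\in L^1[0,T;U']$ and $$(u_2(t)-u_1(t),v)+\int_0^t\lambda\,\bigl(A(u_2(s))-A(u_1(s)),v\bigr)\,ds=0,\qquad t\in[0,T],\ v\in U,$$ then $u_1=u_2$. **Solutions.** Random variables $u$, $V$ on a probability space $(\Omega,\mathcal F,\mathbb P)$ with values in $\mathbb X_1$ and $C[0,T;U']$ form a *solution* of $du=dV-A(u)\,dt$ if $\mathbb P[u\in S]=1$ for some $\sigma$-compact set $S\subseteq\mathbb X_1$, $A(u)\in L^1[0,T;U']$ almost surely,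 and for all $t\in[0,T]$ and $v\in U$, almost surely, $$(u(t),v)=(V(t),v)-\int_0^t(A(u(s)),v)\,ds .$$ **Theorem (Strong Existence).** Let the assumption on $A$ hold and suppose that there is a solution $(\tilde u,\tilde V)$ of $du=dV-A(u)\,dt$ on some probability space. Let $(\Omega,\mathcal F,\mathbb P)$ be any probability space and $V$ a $C[0,T;U']$-valued random variable on it with the same law as $\tilde V$. Then there is an $\mathbb X_1$-valued random variable $u$ on $\Omega$, with range contained in a $\sigma$-compact subset of $\mathbb X_1$, such that $(u,V)$ is a solution, and it is unique: if $(w,V)$ is another solution on $\Omega$, then $w=u$ almost surely. Moreover, $u$ is adapted to the $\mathbb P$-augmentation of the filtration generated by $V$, that is, for every $t\in[0,T]$ the $U'$-valued random variable $u(t)$ is measurable with respect to the $\sigma$-algebra generated by $\{V(s):0\le s\le t\}$ and the events $N\in\mathcal F$ with $\mathbb P(N)=0$. -/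

import Mathlib

open MeasureTheory ProbabilityTheory Set Topology
open scoped ENNReal

namespace EvolutionSPDE

/-- Spaces of continuous functions `C(X, Y)` (with the compact-open topology, which for compact
`X` and normed `Y` is the topology of the supremum norm) carry their Borel σ-algebra. -/
instance instMeasurableSpaceContinuousMap {X Y : Type*} [TopologicalSpace X]
    [TopologicalSpace Y] : MeasurableSpace C(X, Y) := borel _

instance instBorelSpaceContinuousMap {X Y : Type*} [TopologicalSpace X]
    [TopologicalSpace Y] : BorelSpace C(X, Y) := ⟨rfl⟩

section Pivot

variable {U H : Type*} [NormedAddCommGroup U] [NormedSpace ℝ U]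
  [NormedAddCommGroup H] [InnerProductSpace ℝ H]

/-- For a continuous linear map `i : U → H`, the map `H → U'` that sends `h` to the functional
`v ↦ (h, i v)_H`. -/
noncomputable def pivot (i : U →L[ℝ] H) : H →L[ℝ] StrongDual ℝ U :=
  ((ContinuousLinearMap.compL ℝ U H ℝ).flip i).comp (innerSL ℝ)

/-- `pivot i h` is the functional `v ↦ (h, i v)_H`. -/
theorem pivot_apply (i : U →L[ℝ] H) (h : H) (v : U) : pivot i h v = inner ℝ h (i v) := rfl

/-- The dense embeddings `U ↪ H ↪ U'`: the map `i : U → H` is injective (and continuous) with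
dense range, and so is the induced map `H → U'`. -/
structure IsPivotTriple (i : U →L[ℝ] H) : Prop where
  injective_left : Function.Injective i
  denseRange_left : DenseRange i
  injective_right : Function.Injective (pivot i)
  denseRange_right : DenseRange (pivot i)

/-- Lebesgue measure on the interval `[0,T]`. -/
noncomputable abbrev timeMeasure (T : ℝ) : Measure (Icc (0 : ℝ) T) :=
  (volume : Measure ℝ).comap Subtype.val

/-- The path space `C[0,T;U'] ∩ L^r[0,T;U]_weak`. An element is a continuous function with
values in `U'` together with an element of `L^r[0,T;U]` which agrees with it almost everywhere
under the embedding `U ↪ H ↪ U'`. -/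
def PathSpace (i : U →L[ℝ] H) (T : ℝ) (r : ℝ≥0∞) [Fact (1 ≤ r)] : Type _ :=
  {x : C(Icc (0 : ℝ) T, StrongDual ℝ U) ×
      WeakSpace ℝ (Lp U r (timeMeasure T)) //
    ∀ᵐ s ∂timeMeasure T, x.1 s = pivot i (i (((toWeakSpace ℝ
      (Lp U r (timeMeasure T))).symm x.2 : _ → U) s))}

namespace PathSpace

variable {i : U →L[ℝ] H} {T : ℝ} {r : ℝ≥0∞} [Fact (1 ≤ r)]

/-- The topology of the intersection: the coarsest one for which the inclusions into `C[0,T;U']`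
(with the norm topology) and into `L^r[0,T;U]` (with the weak topology) are continuous. -/
noncomputable instance : TopologicalSpace (PathSpace i T r) :=
  instTopologicalSpaceSubtype

noncomputable instance : MeasurableSpace (PathSpace i T r) := borel _

instance : BorelSpace (PathSpace i T r) := ⟨rfl⟩

/-- The continuous `U'`-valued path `t ↦ u(t)`. -/
def path (x : PathSpace i T r) : C(Icc (0 : ℝ) T, StrongDual ℝ U) := x.1.1

/-- A representative of the `U`-valued path, an element of `L^r[0,T;U]`. -/
noncomputable def rep (x : PathSpace i T r) : Icc (0 : ℝ) T → U :=
  ((toWeakSpace ℝ (Lp U r (timeMeasure T))).symm x.1.2 :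
    Lp U r (timeMeasure T))

end PathSpace

/-- Uniqueness for the deterministic equations `du + λ A(u) dt = 0`, `λ > 0`, in difference
form. -/
def DeterministicUniqueness (i : U →L[ℝ] H) (T : ℝ) (r : ℝ≥0∞) [Fact (1 ≤ r)]
    (A : U → StrongDual ℝ U) : Prop :=
  ∀ (lam : ℝ), 0 < lam → ∀ u₁ u₂ : PathSpace i T r,
    Integrable (fun s => A (u₁.rep s)) (timeMeasure T) →
    Integrable (fun s => A (u₂.rep s)) (timeMeasure T) →
    (∀ (t : Icc (0 : ℝ) T) (v : U),
      (u₂.path t - u₁.path t) v +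
        ∫ s in Iic t, lam * (A (u₂.rep s) - A (u₁.rep s)) v ∂timeMeasure T = 0) →
    u₁ = u₂

/-- The pair of random variables `(u, V)` with values in
`(C[0,T;U'] ∩ L^r[0,T;U]_weak) × C[0,T;U']` is a solution of `du = dV - A(u) dt`. -/
structure IsSolution {i : U →L[ℝ] H} {T : ℝ} {r : ℝ≥0∞} [Fact (1 ≤ r)]
    (A : U → StrongDual ℝ U) {Ω : Type*} [MeasurableSpace Ω] (P : Measure Ω)
    (u : Ω → PathSpace i T r) (V : Ω → C(Icc (0 : ℝ) T, StrongDual ℝ U)) : Prop where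
  measurable_left : Measurable u
  measurable_right : Measurable V
  exists_sigmaCompact : ∃ S : Set (PathSpace i T r), IsSigmaCompact S ∧ ∀ᵐ ω ∂P, u ω ∈ S
  integrable : ∀ᵐ ω ∂P, Integrable (fun s => A ((u ω).rep s)) (timeMeasure T)
  equation : ∀ (t : Icc (0 : ℝ) T) (v : U),
    ∀ᵐ ω ∂P, (u ω).path t v = V ω t v - ∫ s in Iic t, A ((u ω).rep s) v ∂timeMeasure T

end Pivot

/-- The `P`-augmentation of the filtration generated by the continuous process `V`: at time `t`
it is the σ-algebra generated by the `V(s)`, `s ≤ t`, and by the `P`-null events. -/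
def augmentedFiltration {E : Type*} [NormedAddCommGroup E] [MeasurableSpace E] [BorelSpace E]
    {T : ℝ} {Ω : Type*} [mΩ : MeasurableSpace Ω] (P : Measure Ω)
    (V : Ω → C(Icc (0 : ℝ) T, E)) (hV : Measurable V) : Filtration (Icc (0 : ℝ) T) mΩ where
  seq t := (⨆ s : Icc (0 : ℝ) T, ⨆ _ : s ≤ t,
      MeasurableSpace.comap (fun ω => V ω s) inferInstance) ⊔
    MeasurableSpace.generateFrom {N : Set Ω | MeasurableSet N ∧ P N = 0}
  mono' s t hst := by
    refine sup_le_sup_right ?_ _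
    exact iSup_mono fun a => iSup_le fun h => le_iSup_of_le (le_trans h hst) le_rfl
  le' t := by
    refine sup_le (iSup_le fun s => iSup_le fun _ => ?_)
      (MeasurableSpace.generateFrom_le fun N hN => hN.1)
    have h : Measurable fun f : C(Icc (0 : ℝ) T, E) => f s :=
      (continuous_eval_const s).measurable
    exact (h.comp hV).comap_le

end EvolutionSPDE

/-!
The argument is a Yamada–Watanabe argument that is short because the noise is additive. If `(u, V)`
solves `du = dV - A(u) dt`, then `V = u + ∫ A(u) ds` is a function of `u`, and deterministic
uniqueness makes this function injective on the paths for which `A(u)` is integrable. Its inverse is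
the solution map.

*Measurability of the solution map.* `A(u)` is a Borel function of the continuous path of `u`
(`exists_measurable_extension`), so `u ↦ V` can be studied on a subset `M` of the Polish space
`C[0,T;U']`. Here `M` is the image of the given σ-compact set `S`, restricted to the paths with
integrable coefficient; it is Borel, and so is the map that recovers an element of `S` from its
continuous path (`PathSpace.exists_measurable_leftInverse_path`). By the Lusin–Souslin theorem the
injective Borel map `u ↦ V` on `M` has Borel range and Borel inverse. The range has full measure
under the law of `V'`, hence under that of `V`, and `u` is the inverse evaluated at `V`. Uniqueness
holds pathwise (`IsPathwiseSolution.unique`).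

*Adaptedness.* Squeezing the interval `[0,T]` onto `[0,t]` turns the equation on `[0,t]` into the
equation with the factor `λ = t / T` on `[0,T]`. Deterministic uniqueness thus yields causality: the
values of `V` on `[0,t]` determine `u(t)` (`DeterministicUniqueness.path_eq`). That this dependence
is Borel is Blackwell's theorem (`exists_measurableSet_preimage_eq`).

The map `u ↦ V` is encoded by the values of `V` at countably many times stopped at `t`
(`signalSample`); these determine `V` on `[0,t]` and are visibly measurable with respect to the
σ-algebra at time `t`.
-/

namespace EvolutionSPDE

/-! ### Lebesgue measure on `[0,T]` and time scaling -/

section Time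

variable {T : ℝ}

theorem timeMeasure_apply (s : Set (Icc (0 : ℝ) T)) :
    timeMeasure T s = volume (Subtype.val '' s) :=
  (MeasurableEmbedding.subtype_coe measurableSet_Icc).comap_apply _ _

instance : IsFiniteMeasure (timeMeasure T) := by
  refine ⟨?_⟩
  rw [timeMeasure_apply]
  exact (measure_mono (image_subset_iff.2 fun x _ => x.2)).trans_lt
    (measure_Icc_lt_top (a := (0 : ℝ)) (b := T))

instance : NullSingletonClass (timeMeasure T) := by
  refine ⟨fun x => ?_⟩
  rw [timeMeasure_apply, image_singleton]
  exact Real.volume_singleton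

theorem continuous_setIntegral_Iic {E : Type*} [NormedAddCommGroup E] [NormedSpace ℝ E]
    {g : Icc (0 : ℝ) T → E} (hg : Integrable g (timeMeasure T)) :
    Continuous fun t => ∫ s in Iic t, g s ∂timeMeasure T := by
  have key : Continuous fun t => ∫ s, (Iic t).indicator g s ∂timeMeasure T := by
    refine continuous_iff_continuousAt.2 fun t₀ => continuousAt_of_dominated
      (.of_forall fun t => hg.aestronglyMeasurable.indicator measurableSet_Iic)
      (.of_forall fun t => .of_forall fun s => norm_indicator_le_norm_self g s) hg.norm ?_
    have h : ∀ᵐ s ∂timeMeasure T, s ≠ t₀ := by simp [ae_iff]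
    filter_upwards [h] with s hs
    -- away from `s = t₀` the indicator of `s ≤ t` is locally constant in `t`
    rcases lt_or_gt_of_ne hs with hlt | hlt
    · refine (continuousAt_const (y := g s)).congr ?_
      filter_upwards [lt_mem_nhds hlt] with t ht
      rw [indicator_of_mem (mem_Iic.2 ht.le)]
    · refine (continuousAt_const (y := (0 : E))).congr ?_
      filter_upwards [gt_mem_nhds hlt] with t ht
      rw [indicator_of_notMem (by simpa using ht)]
  simpa only [integral_indicator measurableSet_Iic] using key

/-- The map `s ↦ (t / T) s`, which squeezes `[0,T]` onto `[0,t]`. -/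
noncomputable def timeScale (hT : 0 < T) (t : Icc (0 : ℝ) T) :
    C(Icc (0 : ℝ) T, Icc (0 : ℝ) T) where
  toFun s := ⟨t / T * s, mul_nonneg (div_nonneg t.2.1 hT.le) s.2.1, by
    have h1 : (t : ℝ) / T ≤ 1 := (div_le_one hT).2 t.2.2
    calc (t : ℝ) / T * s ≤ 1 * T := mul_le_mul h1 s.2.2 s.2.1 zero_le_one
      _ = T := one_mul T⟩
  continuous_toFun := by fun_prop

@[simp]
theorem coe_timeScale (hT : 0 < T) (t s : Icc (0 : ℝ) T) :
    (timeScale hT t s : ℝ) = t / T * s := rfl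

theorem timeScale_le (hT : 0 < T) (t s : Icc (0 : ℝ) T) : timeScale hT t s ≤ t := by
  rw [← Subtype.coe_le_coe, coe_timeScale, div_mul_eq_mul_div, div_le_iff₀ hT]
  exact mul_le_mul_of_nonneg_left s.2.2 t.2.1

theorem timeScale_end (hT : 0 < T) (t : Icc (0 : ℝ) T) :
    timeScale hT t ⟨T, hT.le, le_rfl⟩ = t := by
  ext
  rw [coe_timeScale]
  field_simp

theorem timeScale_le_timeScale_iff (hT : 0 < T) {t : Icc (0 : ℝ) T} (ht : 0 < (t : ℝ))
    (a b : Icc (0 : ℝ) T) : timeScale hT t a ≤ timeScale hT t b ↔ a ≤ b := by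
  rw [← Subtype.coe_le_coe, ← Subtype.coe_le_coe, coe_timeScale, coe_timeScale,
    mul_le_mul_iff_right₀ (div_pos ht hT)]

theorem measurableEmbedding_timeScale (hT : 0 < T) {t : Icc (0 : ℝ) T} (ht : 0 < (t : ℝ)) :
    MeasurableEmbedding (timeScale hT t) :=
  (timeScale hT t).continuous.measurableEmbedding fun a b hab =>
    le_antisymm ((timeScale_le_timeScale_iff hT ht a b).1 hab.le)
      ((timeScale_le_timeScale_iff hT ht b a).1 hab.ge)

theorem map_timeScale (hT : 0 < T) {t : Icc (0 : ℝ) T} (ht : 0 < (t : ℝ)) :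
    (timeMeasure T).map (timeScale hT t) =
      ENNReal.ofReal (T / t) • (timeMeasure T).restrict (Iic t) := by
  ext s hs
  have him : (Subtype.val '' (timeScale hT t ⁻¹' s) : Set ℝ) =
      (fun x => (t / T : ℝ) * x) ⁻¹' (Subtype.val '' (s ∩ Iic t)) := by
    ext x
    constructor
    · rintro ⟨a, ha, rfl⟩
      exact ⟨timeScale hT t a, ⟨ha, timeScale_le hT t a⟩, rfl⟩
    · rintro ⟨b, ⟨hb, hbt⟩, hbx⟩
      have hx : x = b * T / t := by
        have : (b : ℝ) = t / T * x := hbx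
        rw [this]; field_simp
      have hbt' : (b : ℝ) ≤ t := hbt
      have hx_mem : x ∈ Icc (0 : ℝ) T := by
        rw [hx, mem_Icc, div_le_iff₀ ht, mul_comm]
        exact ⟨div_nonneg (mul_nonneg hT.le b.2.1) ht.le, mul_le_mul_of_nonneg_left hbt' hT.le⟩
      have hbx' : timeScale hT t ⟨x, hx_mem⟩ = b := Subtype.ext hbx.symm
      exact ⟨⟨x, hx_mem⟩, by rwa [mem_preimage, hbx'], rfl⟩
  rw [(measurableEmbedding_timeScale hT ht).map_apply, timeMeasure_apply, him,
    Real.volume_preimage_mul_left (div_pos ht hT).ne', Measure.smul_apply,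
    Measure.restrict_apply hs, timeMeasure_apply, inv_div, abs_of_pos (div_pos hT ht), smul_eq_mul]

theorem quasiMeasurePreserving_timeScale (hT : 0 < T) {t : Icc (0 : ℝ) T} (ht : 0 < (t : ℝ)) :
    Measure.QuasiMeasurePreserving (timeScale hT t) (timeMeasure T) (timeMeasure T) := by
  refine ⟨(timeScale hT t).continuous.measurable, ?_⟩
  rw [map_timeScale hT ht]
  exact (Measure.smul_absolutelyContinuous).trans Measure.restrict_le_self.absolutelyContinuous

/-- The substitution rule for the squeezing of `[0,T]` onto `[0,t]`. -/
theorem setIntegral_comp_timeScale (hT : 0 < T) {t : Icc (0 : ℝ) T} (ht : 0 < (t : ℝ))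
    (g : Icc (0 : ℝ) T → ℝ) (s : Icc (0 : ℝ) T) :
    ∫ x in Iic s, t / T * g (timeScale hT t x) ∂timeMeasure T =
      ∫ x in Iic (timeScale hT t s), g x ∂timeMeasure T := by
  have hpre : timeScale hT t ⁻¹' Iic (timeScale hT t s) = Iic s := by
    ext a; exact timeScale_le_timeScale_iff hT ht a s
  have h := (measurableEmbedding_timeScale hT ht).setIntegral_map (μ := timeMeasure T) g
    (Iic (timeScale hT t s))
  rw [hpre, map_timeScale hT ht, Measure.restrict_smul, Measure.restrict_restrict measurableSet_Iic,
    inter_eq_left.2 (Iic_subset_Iic.2 (timeScale_le hT t s)), integral_smul_measure,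
    ENNReal.toReal_ofReal (div_pos hT ht).le] at h
  rw [integral_const_mul, ← h, smul_eq_mul]
  field_simp

end Time

/-! ### The path space -/

section Path

variable {U H : Type*} [NormedAddCommGroup U] [NormedSpace ℝ U]
  [NormedAddCommGroup H] [InnerProductSpace ℝ H]

theorem IsPivotTriple.injective_pivot_comp {i : U →L[ℝ] H} (hi : IsPivotTriple i) :
    Function.Injective fun v => pivot i (i v) :=
  hi.injective_right.comp hi.injective_left

theorem IsPivotTriple.separableSpace_dual [TopologicalSpace.SeparableSpace U] {i : U →L[ℝ] H}
    (hi : IsPivotTriple i) : TopologicalSpace.SeparableSpace (StrongDual ℝ U) :=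
  haveI := hi.denseRange_left.separableSpace i.continuous
  hi.denseRange_right.separableSpace (pivot i).continuous

variable {i : U →L[ℝ] H} {T : ℝ} {r : ℝ≥0∞} [Fact (1 ≤ r)]

namespace PathSpace

theorem path_ae_eq (u : PathSpace i T r) :
    ∀ᵐ s ∂timeMeasure T, u.path s = pivot i (i (u.rep s)) := u.2

theorem continuous_path : Continuous (path : PathSpace i T r → _) :=
  continuous_fst.comp continuous_subtype_val

theorem path_injective (hi : IsPivotTriple i) :
    Function.Injective (path : PathSpace i T r → _) := by
  intro u w h
  refine Subtype.ext (Prod.ext h ((toWeakSpace ℝ _).symm.injective (Lp.ext ?_)))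
  filter_upwards [u.path_ae_eq, w.path_ae_eq] with s hu hw
  exact hi.injective_pivot_comp (hu.symm.trans ((congrArg (fun y => y s) h).trans hw))

/-- The path `s ↦ u((t / T) s)` belongs to the path space along with `u`. -/
theorem exists_timeScale (hT : 0 < T) {t : Icc (0 : ℝ) T} (ht : 0 < (t : ℝ))
    (u : PathSpace i T r) :
    ∃ w : PathSpace i T r, w.path = u.path.comp (timeScale hT t) ∧
      w.rep =ᵐ[timeMeasure T] u.rep ∘ timeScale hT t := by
  have hqmp := quasiMeasurePreserving_timeScale hT ht
  have hu : MemLp u.rep r (timeMeasure T) := Lp.memLp _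
  have hmem : MemLp (u.rep ∘ timeScale hT t) r (timeMeasure T) := by
    refine MemLp.comp_of_map ?_ hqmp.measurable.aemeasurable
    rw [map_timeScale hT ht]
    exact (hu.restrict _).smul_measure ENNReal.ofReal_ne_top
  refine ⟨⟨(u.path.comp (timeScale hT t), toWeakSpace ℝ _ (hmem.toLp _)), ?_⟩, rfl, ?_⟩
  · filter_upwards [hqmp.ae u.path_ae_eq, hmem.coeFn_toLp] with s h1 h2
    simp only [LinearEquiv.symm_apply_apply, ContinuousMap.comp_apply]
    rw [h2]
    exact h1
  · exact hmem.coeFn_toLp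

/-- On a σ-compact set, the inverse of the continuous injection `path` of the path space into
`C[0,T;U']` is Borel: images of relatively closed subsets of compact sets are compact, hence
closed. -/
theorem exists_measurable_leftInverse_path (hi : IsPivotTriple i) {S : Set (PathSpace i T r)}
    (hS : IsSigmaCompact S) (hne : S.Nonempty) :
    MeasurableSet (path '' S) ∧ ∃ g : C(Icc (0 : ℝ) T, StrongDual ℝ U) → PathSpace i T r,
      Measurable g ∧ (∀ y, g y ∈ S) ∧ ∀ u ∈ S, g u.path = u := by
  classical
  obtain ⟨K, hK, hKS⟩ := hS
  obtain ⟨u₀, hu₀⟩ := hne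
  have hclosed : ∀ C : Set (PathSpace i T r), IsClosed C → MeasurableSet (path '' (S ∩ C)) := by
    intro C hC
    rw [← hKS, iUnion_inter, image_iUnion]
    exact .iUnion fun n =>
      (((hK n).inter_right hC).image continuous_path).isClosed.measurableSet
  have hSm : MeasurableSet (path '' S) := by simpa using hclosed univ isClosed_univ
  let g : C(Icc (0 : ℝ) T, StrongDual ℝ U) → PathSpace i T r := fun y =>
    if h : y ∈ path '' S then h.choose else u₀
  have hg : ∀ u ∈ S, g u.path = u := by
    intro u hu
    have h : u.path ∈ path '' S := mem_image_of_mem _ hu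
    simp only [g, dif_pos h]
    exact path_injective hi h.choose_spec.2
  have hg' : ∀ y ∉ path '' S, g y = u₀ := fun y hy => dif_neg hy
  refine ⟨hSm, g, measurable_of_isClosed fun C hC => ?_, fun y => ?_, hg⟩
  · have : g ⁻¹' C = path '' (S ∩ C) ∪ ((path '' S)ᶜ ∩ {_y | u₀ ∈ C}) := by
      ext y
      by_cases hy : y ∈ path '' S
      · obtain ⟨u, hu, rfl⟩ := hy
        have : u.path ∈ path '' (S ∩ C) ↔ u ∈ C := by
          rw [(path_injective hi).mem_set_image]
          exact ⟨fun h => h.2, fun h => ⟨hu, h⟩⟩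
        simp [hg u hu, this, hu, (path_injective hi).eq_iff]
      · have : y ∉ path '' (S ∩ C) := fun h => hy (image_mono inter_subset_left h)
        simp only [mem_preimage, hg' y hy, mem_union, this, false_or, mem_inter_iff, mem_compl_iff,
          hy, not_false_eq_true, true_and, mem_ofPred_eq]
    rw [this]
    exact (hclosed C hC).union (hSm.compl.inter (.const _))
  · by_cases hy : y ∈ path '' S
    · obtain ⟨u, hu, rfl⟩ := hy
      rwa [hg u hu]
    · rwa [hg' y hy]

end PathSpace

/-- Causality. Squeezing `[0,T]` onto `[0,t]` turns the equation with factor `1` up to time `t`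
into the equation with factor `λ = t / T` on all of `[0,T]`, so that deterministic uniqueness
determines a solution at time `t` by the data up to time `t`. -/
theorem DeterministicUniqueness.path_eq {A : U → StrongDual ℝ U}
    (hA : DeterministicUniqueness i T r A) (hT : 0 < T) {u₁ u₂ : PathSpace i T r}
    (h₁ : Integrable (fun s => A (u₁.rep s)) (timeMeasure T))
    (h₂ : Integrable (fun s => A (u₂.rep s)) (timeMeasure T)) {t : Icc (0 : ℝ) T}
    (h : ∀ s ≤ t, ∀ v : U, (u₂.path s - u₁.path s) v +
      ∫ x in Iic s, (A (u₂.rep x) - A (u₁.rep x)) v ∂timeMeasure T = 0) :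
    u₁.path t = u₂.path t := by
  rcases t.2.1.eq_or_lt with ht | ht
  · -- the squeezing degenerates at `t = 0`, where the integral vanishes
    have hIic : Iic t = {t} := by
      ext a
      refine ⟨fun ha => le_antisymm ha ?_, fun ha => (mem_singleton_iff.1 ha).le⟩
      rw [← Subtype.coe_le_coe, ← ht]
      exact a.2.1
    ext v
    have := h t le_rfl v
    rw [hIic, Measure.restrict_singleton, measure_singleton, zero_smul, integral_zero_measure,
      add_zero, sub_apply, sub_eq_zero] at this
    exact this.symm
  · obtain ⟨w₁, hp₁, hr₁⟩ := u₁.exists_timeScale hT ht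
    obtain ⟨w₂, hp₂, hr₂⟩ := u₂.exists_timeScale hT ht
    have hint : ∀ u w : PathSpace i T r, w.rep =ᵐ[timeMeasure T] u.rep ∘ timeScale hT t →
        Integrable (fun s => A (u.rep s)) (timeMeasure T) →
        Integrable (fun s => A (w.rep s)) (timeMeasure T) := by
      intro u w hr hu
      have hmap : Integrable (fun s => A (u.rep s)) ((timeMeasure T).map (timeScale hT t)) := by
        rw [map_timeScale hT ht]
        exact Integrable.smul_measure (ε := StrongDual ℝ U) hu.restrict ENNReal.ofReal_ne_top
      refine (hmap.comp_measurable (timeScale hT t).continuous.measurable).congr ?_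
      filter_upwards [hr] with s hs
      rw [hs]; rfl
    have hw : w₁ = w₂ := by
      refine hA (t / T) (div_pos ht hT) w₁ w₂ (hint _ _ hr₁ h₁) (hint _ _ hr₂ h₂) fun s v => ?_
      have hs := h (timeScale hT t s) (timeScale_le hT t s) v
      rw [← setIntegral_comp_timeScale hT ht] at hs
      rw [hp₁, hp₂]
      refine Eq.trans (congrArg₂ _ rfl (integral_congr_ae (ae_restrict_of_ae ?_))) hs
      filter_upwards [hr₁, hr₂] with x hx₁ hx₂
      rw [hx₁, hx₂]; rfl
    have := congrArg (fun w => w.path ⟨T, hT.le, le_rfl⟩) hw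
    simpa only [hp₁, hp₂, ContinuousMap.comp_apply, timeScale_end] using this

end Path
/-! ### Measurability: Blackwell's theorem, augmented filtrations, function spaces -/

/-- Blackwell's theorem: a measurable set of a standard Borel space that is a union of fibres of a
measurable map `f` belongs to the σ-algebra generated by `f`. The images of the set and of its
complement are disjoint analytic sets, and a Borel set separates them. -/
theorem exists_measurableSet_preimage_eq {X Y : Type*} [MeasurableSpace X] [StandardBorelSpace X]
    [TopologicalSpace Y] [T2Space Y] [SecondCountableTopology Y] [MeasurableSpace Y]
    [OpensMeasurableSpace Y] {f : X → Y} (hf : Measurable f) {E : Set X} (hE : MeasurableSet E)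
    (h : ∀ a b, f a = f b → a ∈ E → b ∈ E) : ∃ D, MeasurableSet D ∧ f ⁻¹' D = E := by
  have hdisj : Disjoint (f '' E) (f '' Eᶜ) := by
    rw [disjoint_left]
    rintro _ ⟨a, ha, rfl⟩ ⟨b, hb, hab⟩
    exact hb (h a b hab.symm ha)
  obtain ⟨D, hED, hD, hDm⟩ :=
    (hE.analyticSet_image hf).measurablySeparable (hE.compl.analyticSet_image hf) hdisj
  refine ⟨D, hDm, Subset.antisymm (fun a ha => ?_) fun a ha => hED (mem_image_of_mem f ha)⟩
  by_contra hn
  exact disjoint_left.1 hD (mem_image_of_mem f hn) ha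

section Augmented

variable {E : Type*} [NormedAddCommGroup E] [MeasurableSpace E] [BorelSpace E]
  {T : ℝ} {Ω : Type*} [MeasurableSpace Ω] {P : Measure Ω} {V : Ω → C(Icc (0 : ℝ) T, E)}

theorem measurable_augmentedFiltration_eval (hV : Measurable V) {s t : Icc (0 : ℝ) T}
    (hst : s ≤ t) : Measurable[augmentedFiltration P V hV t] fun ω => V ω s :=
  (comap_measurable _).mono
    ((le_iSup₂_of_le (f := fun s (_ : s ≤ t) =>
      MeasurableSpace.comap (fun ω => V ω s) inferInstance) s hst le_rfl).trans le_sup_left) le_rfl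

/-- The augmented σ-algebras contain every event that is almost surely equal to one of theirs. -/
theorem measurableSet_augmentedFiltration_of_ae_eq (hV : Measurable V) {t : Icc (0 : ℝ) T}
    {D D' : Set Ω} (hD : MeasurableSet D) (hD' : MeasurableSet[augmentedFiltration P V hV t] D')
    (h : D =ᵐ[P] D') : MeasurableSet[augmentedFiltration P V hV t] D := by
  have hnull : ∀ N, MeasurableSet N → P N = 0 →
      MeasurableSet[augmentedFiltration P V hV t] N := fun N hN hN0 =>
    (le_sup_right : MeasurableSpace.generateFrom {N : Set Ω | MeasurableSet N ∧ P N = 0} ≤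
      augmentedFiltration P V hV t) N (MeasurableSpace.measurableSet_generateFrom ⟨hN, hN0⟩)
  have hD'm := (augmentedFiltration P V hV).le t D' hD'
  obtain ⟨h1, h2⟩ := ae_eq_set.1 h
  have : D = (D' \ (D' \ D)) ∪ (D \ D') := by
    ext ω
    simp only [mem_union, mem_sdiff]
    tauto
  rw [this]
  exact (hD'.diff (hnull _ (hD'm.diff hD) h2)).union (hnull _ (hD.diff hD'm) h1)

end Augmented

theorem polishSpace_continuousMap {X E : Type*} [TopologicalSpace X] [CompactSpace X]
    [LocallyCompactSpace X] [SecondCountableTopology X] [MetricSpace E] [CompleteSpace E]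
    [SecondCountableTopology E] : PolishSpace C(X, E) := {}

/-! ### Pathwise solutions -/

section Pathwise

variable {U H : Type*} [NormedAddCommGroup U] [NormedSpace ℝ U]
  [NormedAddCommGroup H] [InnerProductSpace ℝ H]
  {i : U →L[ℝ] H} {T : ℝ} {r : ℝ≥0∞} [Fact (1 ≤ r)] {A : U → StrongDual ℝ U}

/-- The deterministic path `u` solves `du = dV - A(u) dt` for the deterministic signal `V`; the
equation is required to hold at all times, as an identity in `U'`. -/
structure IsPathwiseSolution (A : U → StrongDual ℝ U) (u : PathSpace i T r)
    (V : C(Icc (0 : ℝ) T, StrongDual ℝ U)) : Prop where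
  integrable : Integrable (fun s => A (u.rep s)) (timeMeasure T)
  signal_eq : ∀ t, V t = u.path t + ∫ s in Iic t, A (u.rep s) ∂timeMeasure T

theorem exists_isPathwiseSolution {u : PathSpace i T r}
    (hu : Integrable (fun s => A (u.rep s)) (timeMeasure T)) :
    ∃ V, IsPathwiseSolution A u V :=
  ⟨⟨fun t => u.path t + ∫ s in Iic t, A (u.rep s) ∂timeMeasure T,
    u.path.continuous.add (continuous_setIntegral_Iic hu)⟩, hu, fun _ => rfl⟩

/-- By separability and continuity the exceptional null sets of the equation can be chosen
independently of the time and of the test vector. -/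
theorem IsSolution.ae_isPathwiseSolution [TopologicalSpace.SeparableSpace U]
    {Ω : Type*} [MeasurableSpace Ω] {P : Measure Ω} {u : Ω → PathSpace i T r}
    {V : Ω → C(Icc (0 : ℝ) T, StrongDual ℝ U)} (h : IsSolution A P u V) :
    ∀ᵐ ω ∂P, IsPathwiseSolution A (u ω) (V ω) := by
  obtain ⟨Q, hQc, hQ⟩ := TopologicalSpace.exists_countable_dense (Icc (0 : ℝ) T)
  obtain ⟨W, hWc, hW⟩ := TopologicalSpace.exists_countable_dense U
  have hae : ∀ᵐ ω ∂P, ∀ t ∈ Q, ∀ v ∈ W, (u ω).path t v =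
      V ω t v - ∫ s in Iic t, A ((u ω).rep s) v ∂timeMeasure T :=
    (ae_ball_iff hQc).2 fun t _ => (ae_ball_iff hWc).2 fun v _ => h.equation t v
  filter_upwards [hae, h.integrable] with ω hω hint
  refine ⟨hint, fun t => ?_⟩
  have hcont := (u ω).path.continuous.add (continuous_setIntegral_Iic hint)
  refine congrFun (Continuous.ext_on hQ (V ω).continuous hcont fun t ht => ?_) t
  refine ContinuousLinearMap.coeFn_injective
    (Continuous.ext_on hW (V ω t).continuous (ContinuousLinearMap.continuous _) fun v hv => ?_)
  change V ω t v = ((u ω).path t + ∫ s in Iic t, A ((u ω).rep s) ∂timeMeasure T) v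
  rw [add_apply, hω t ht v hv, ContinuousLinearMap.integral_apply hint.restrict,
    sub_add_cancel]

namespace IsPathwiseSolution

theorem equation {u : PathSpace i T r} {V : C(Icc (0 : ℝ) T, StrongDual ℝ U)}
    (h : IsPathwiseSolution A u V) (t : Icc (0 : ℝ) T) (v : U) :
    u.path t v = V t v - ∫ s in Iic t, A (u.rep s) v ∂timeMeasure T := by
  rw [h.signal_eq t, add_apply, ContinuousLinearMap.integral_apply h.integrable.restrict,
    add_sub_cancel_right]

/-- Signals that agree up to time `t` have solutions that agree at time `t`. -/
theorem path_eq (hA : DeterministicUniqueness i T r A) (hT : 0 < T) {u₁ u₂ : PathSpace i T r}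
    {V₁ V₂ : C(Icc (0 : ℝ) T, StrongDual ℝ U)} (h₁ : IsPathwiseSolution A u₁ V₁)
    (h₂ : IsPathwiseSolution A u₂ V₂) {t : Icc (0 : ℝ) T} (h : ∀ s ≤ t, V₁ s = V₂ s) :
    u₁.path t = u₂.path t := by
  refine hA.path_eq hT h₁.integrable h₂.integrable fun s hs v => ?_
  have hsub : Integrable (fun x => A (u₂.rep x) - A (u₁.rep x)) (timeMeasure T) :=
    h₂.integrable.sub h₁.integrable
  rw [← ContinuousLinearMap.integral_apply hsub.restrict,
    integral_sub h₂.integrable.restrict h₁.integrable.restrict, ← add_apply]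
  have e := h s hs
  rw [h₁.signal_eq s, h₂.signal_eq s] at e
  rw [sub_add_sub_comm, e, sub_self, zero_apply]

theorem unique (hi : IsPivotTriple i) (hA : DeterministicUniqueness i T r A) (hT : 0 < T)
    {u₁ u₂ : PathSpace i T r} {V : C(Icc (0 : ℝ) T, StrongDual ℝ U)}
    (h₁ : IsPathwiseSolution A u₁ V) (h₂ : IsPathwiseSolution A u₂ V) : u₁ = u₂ :=
  PathSpace.path_injective hi (ContinuousMap.ext fun _ => path_eq hA hT h₁ h₂ fun _ _ => rfl)

end IsPathwiseSolution

/-- The operator `A` extends from `U` to a Borel map on `U'`, because the injection `U → U'` is a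
Borel isomorphism onto its image. The coefficient `A(u)` thereby becomes a function of the
continuous path of `u` alone. -/
theorem exists_measurable_extension [CompleteSpace U] [TopologicalSpace.SeparableSpace U]
    [MeasurableSpace U] [BorelSpace U] (hi : IsPivotTriple i) (hA : Measurable A) :
    ∃ B : StrongDual ℝ U → StrongDual ℝ U, Measurable B ∧ ∀ v, B (pivot i (i v)) = A v := by
  have : SecondCountableTopology U := UniformSpace.secondCountable_of_separable U
  have : PolishSpace U := {}
  have hemb : MeasurableEmbedding fun v => pivot i (i v) :=
    ((pivot i).continuous.comp i.continuous).measurableEmbedding hi.injective_pivot_comp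
  obtain ⟨B, hB, hBA⟩ := hemb.exists_measurable_extend hA fun _ => ⟨0⟩
  exact ⟨B, hB, congrFun hBA⟩

end Pathwise

/-! ### Sampling at countably many times -/

section Sampling

variable {E : Type*} [NormedAddCommGroup E] {T : ℝ}

/-- The values of `V` at the times `q n`, stopped at time `t`. -/
def sample (q : ℕ → Icc (0 : ℝ) T) (t : Icc (0 : ℝ) T) (V : C(Icc (0 : ℝ) T, E)) : ℕ → E :=
  fun n => V (min (q n) t)

theorem eq_of_sample_eq {q : ℕ → Icc (0 : ℝ) T} (hq : DenseRange q) {t : Icc (0 : ℝ) T}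
    {V₁ V₂ : C(Icc (0 : ℝ) T, E)} (h : sample q t V₁ = sample q t V₂) {s : Icc (0 : ℝ) T}
    (hs : s ≤ t) : V₁ s = V₂ s := by
  have := congrFun (hq.equalizer (V₁.continuous.comp (continuous_id.min continuous_const))
    (V₂.continuous.comp (continuous_id.min continuous_const)) h) s
  simpa [min_eq_left hs] using this

theorem measurable_sample [MeasurableSpace E] [BorelSpace E] (q : ℕ → Icc (0 : ℝ) T)
    (t : Icc (0 : ℝ) T) : Measurable (sample (E := E) q t) :=
  measurable_pi_lambda _ fun _ => (continuous_eval_const _).measurable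

variable [MeasurableSpace E] [BorelSpace E] [SecondCountableTopology E]

theorem stronglyMeasurable_uncurry_comp {B : E → E} (hB : Measurable B) :
    StronglyMeasurable
      (Function.uncurry fun (y : C(Icc (0 : ℝ) T, E)) (s : Icc (0 : ℝ) T) => B (y s)) :=
  (hB.comp (continuous_eval (F := C(Icc (0 : ℝ) T, E))).measurable).stronglyMeasurable

variable [NormedSpace ℝ E]

/-- The samples, in the sense of `sample`, of the signal `y + ∫ B(y) ds` that drives the path `y`
in the equation `dy = dV - B(y) dt`. Only paths with integrable `B(y)` are of interest; the integral
has its junk value for the others. -/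
noncomputable def signalSample (B : E → E) (q : ℕ → Icc (0 : ℝ) T) (t : Icc (0 : ℝ) T)
    (y : C(Icc (0 : ℝ) T, E)) : ℕ → E :=
  fun n => y (min (q n) t) + ∫ s in Iic (min (q n) t), B (y s) ∂timeMeasure T

theorem measurable_signalSample {B : E → E} (hB : Measurable B) (q : ℕ → Icc (0 : ℝ) T)
    (t : Icc (0 : ℝ) T) : Measurable (signalSample B q t) :=
  measurable_pi_lambda _ fun _ => (continuous_eval_const _).measurable.add
    (stronglyMeasurable_uncurry_comp hB).integral_prod_right.measurable

variable {U H : Type*} [NormedAddCommGroup U] [NormedSpace ℝ U]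
  [NormedAddCommGroup H] [InnerProductSpace ℝ H]
  {i : U →L[ℝ] H} {r : ℝ≥0∞} [Fact (1 ≤ r)] {A : U → StrongDual ℝ U}

theorem PathSpace.ae_comp_rep_eq {B : StrongDual ℝ U → StrongDual ℝ U}
    (hBA : ∀ v, B (pivot i (i v)) = A v) (u : PathSpace i T r) :
    (fun s => A (u.rep s)) =ᵐ[timeMeasure T] fun s => B (u.path s) := by
  filter_upwards [u.path_ae_eq] with s hs
  rw [hs, hBA]

theorem IsPathwiseSolution.signalSample_eq {B : StrongDual ℝ U → StrongDual ℝ U}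
    (hBA : ∀ v, B (pivot i (i v)) = A v) {u : PathSpace i T r}
    {V : C(Icc (0 : ℝ) T, StrongDual ℝ U)} (h : IsPathwiseSolution A u V)
    (q : ℕ → Icc (0 : ℝ) T) (t : Icc (0 : ℝ) T) :
    signalSample B q t u.path = sample q t V := by
  funext n
  rw [signalSample, sample, h.signal_eq,
    integral_congr_ae (ae_restrict_of_ae (u.ae_comp_rep_eq hBA))]

end Sampling

end EvolutionSPDE

/-! ### Strong existence -/

open EvolutionSPDE in
theorem mainTheorem7
    {U H : Type*} [NormedAddCommGroup U] [NormedSpace ℝ U] [CompleteSpace U]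
    [TopologicalSpace.SeparableSpace U] [MeasurableSpace U] [BorelSpace U]
    [NormedAddCommGroup H] [InnerProductSpace ℝ H] [CompleteSpace H]
    (i : U →L[ℝ] H) (hi : EvolutionSPDE.IsPivotTriple i)
    (T : ℝ) (hT : 0 < T)
    (r : ℝ≥0∞) [Fact (1 ≤ r)] (hr_one : 1 < r) (hr_top : r < ∞)
    (A : U → StrongDual ℝ U) (hA_meas : Measurable A)
    (hA : EvolutionSPDE.DeterministicUniqueness i T r A)
    {Ω' : Type*} [MeasurableSpace Ω'] (P' : Measure Ω') [IsProbabilityMeasure P']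
    (u' : Ω' → EvolutionSPDE.PathSpace i T r) (V' : Ω' → C(Icc (0 : ℝ) T, StrongDual ℝ U))
    (h_sol : EvolutionSPDE.IsSolution A P' u' V')
    {Ω : Type*} [MeasurableSpace Ω] (P : Measure Ω) [IsProbabilityMeasure P]
    (V : Ω → C(Icc (0 : ℝ) T, StrongDual ℝ U)) (hV : Measurable V)
    (h_law : P.map V = P'.map V') :
    ∃ u : Ω → EvolutionSPDE.PathSpace i T r,
      (∃ S : Set (EvolutionSPDE.PathSpace i T r), IsSigmaCompact S ∧ range u ⊆ S) ∧
      EvolutionSPDE.IsSolution A P u V ∧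
      (∀ w : Ω → EvolutionSPDE.PathSpace i T r,
        EvolutionSPDE.IsSolution A P w V → w =ᵐ[P] u) ∧
      Adapted (EvolutionSPDE.augmentedFiltration P V hV) (fun t ω => (u ω).path t) := by
  have := hi.separableSpace_dual
  have : SecondCountableTopology (StrongDual ℝ U) := UniformSpace.secondCountable_of_separable _
  have : PolishSpace C(Icc (0 : ℝ) T, StrongDual ℝ U) := polishSpace_continuousMap
  obtain ⟨B, hB, hBA⟩ := exists_measurable_extension hi hA_meas
  have hint_iff : ∀ u : PathSpace i T r, Integrable (fun s => A (u.rep s)) (timeMeasure T) ↔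
      Integrable (fun s => B (u.path s)) (timeMeasure T) :=
    fun u => integrable_congr (u.ae_comp_rep_eq hBA)
  obtain ⟨S, hS, huS⟩ := h_sol.exists_sigmaCompact
  have hne : S.Nonempty := huS.exists.elim fun ω h => ⟨u' ω, h⟩
  obtain ⟨hSm, g, hg, hgS, hg_path⟩ := PathSpace.exists_measurable_leftInverse_path hi hS hne
  let τ : Icc (0 : ℝ) T := ⟨T, hT.le, le_rfl⟩
  have : Nonempty (Icc (0 : ℝ) T) := ⟨τ⟩
  let q := TopologicalSpace.denseSeq (Icc (0 : ℝ) T)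
  have hq : DenseRange q := TopologicalSpace.denseRange_denseSeq _
  -- the paths of the elements of `S` for which the equation makes sense
  let M : Set C(Icc (0 : ℝ) T, StrongDual ℝ U) :=
    PathSpace.path '' S ∩ {y | Integrable (fun s => B (y s)) (timeMeasure T)}
  have hM : MeasurableSet M :=
    hSm.inter (measurableSet_integrable (stronglyMeasurable_uncurry_comp hB))
  have : StandardBorelSpace M := hM.standardBorel
  have hM_iff : ∀ y ∈ M, ∃ u ∈ S, u.path = y ∧ ∃ W, IsPathwiseSolution A u W := by
    rintro _ ⟨⟨u, hu, rfl⟩, hint⟩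
    exact ⟨u, hu, rfl, exists_isPathwiseSolution ((hint_iff u).2 hint)⟩
  have hmem_M : ∀ u ∈ S, ∀ W, IsPathwiseSolution A u W → u.path ∈ M := fun u hu W h =>
    ⟨mem_image_of_mem _ hu, (hint_iff u).1 h.integrable⟩
  let F : Icc (0 : ℝ) T → M → ℕ → StrongDual ℝ U := fun t y => signalSample B q t y
  have hF : ∀ t, Measurable (F t) := fun t =>
    (measurable_signalSample hB q t).comp measurable_subtype_coe
  have hF_det : ∀ {t s : Icc (0 : ℝ) T} {y₁ y₂ : M}, F t y₁ = F t y₂ → s ≤ t →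
      y₁.1 s = y₂.1 s := by
    rintro t s ⟨y₁, hy₁⟩ ⟨y₂, hy₂⟩ h hst
    obtain ⟨u₁, -, rfl, W₁, h₁⟩ := hM_iff y₁ hy₁
    obtain ⟨u₂, -, rfl, W₂, h₂⟩ := hM_iff y₂ hy₂
    simp only [F, h₁.signalSample_eq hBA, h₂.signalSample_eq hBA] at h
    exact h₁.path_eq hA hT h₂ fun s' hs' => eq_of_sample_eq hq h (hs'.trans hst)
  have hF_emb : MeasurableEmbedding (F τ) := (hF τ).measurableEmbedding fun y₁ y₂ h =>
    Subtype.ext (ContinuousMap.ext fun s => hF_det h s.2.2)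
  obtain ⟨χ, hχ, hχF⟩ := hF_emb.exists_measurable_extend measurable_subtype_coe
    fun _ => (inferInstance : Nonempty C(Icc (0 : ℝ) T, StrongDual ℝ U))
  let u : Ω → PathSpace i T r := fun ω => g (χ (sample q τ (V ω)))
  have hu : Measurable u := hg.comp (hχ.comp ((measurable_sample q τ).comp hV))
  have hu_sol : ∀ᵐ ω ∂P, IsPathwiseSolution A (u ω) (V ω) := by
    -- equality of laws transports the solvability of the equation from `V'` to `V`
    have hmeas : MeasurableSet {W | sample q τ W ∈ range (F τ)} :=
      measurable_sample q τ hF_emb.measurableSet_range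
    have hV' : ∀ᵐ ω ∂P', sample q τ (V' ω) ∈ range (F τ) := by
      filter_upwards [huS, h_sol.ae_isPathwiseSolution] with ω h1 h2
      exact ⟨⟨_, hmem_M _ h1 _ h2⟩, h2.signalSample_eq hBA q τ⟩
    rw [← ae_map_iff h_sol.measurable_right.aemeasurable hmeas, ← h_law,
      ae_map_iff hV.aemeasurable hmeas] at hV'
    filter_upwards [hV'] with ω hω
    obtain ⟨y, hy⟩ := hω
    obtain ⟨u₀, hu₀, hu₀y, W, hW⟩ := hM_iff y y.2
    have hu_eq : u ω = u₀ := by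
      have : χ (F τ y) = y := congrFun hχF y
      simp only [u, ← hy, this, ← hu₀y, hg_path u₀ hu₀]
    have hW_eq : W = V ω := ContinuousMap.ext fun s => by
      refine eq_of_sample_eq hq (t := τ) ?_ s.2.2
      rw [← hy, ← hW.signalSample_eq hBA, hu₀y]
    rwa [hu_eq, ← hW_eq]
  refine ⟨u, ⟨S, hS, range_subset_iff.2 fun ω => hgS _⟩,
    ⟨hu, hV, ⟨S, hS, .of_forall fun ω => hgS _⟩,
    hu_sol.mono fun ω h => h.integrable, fun t v => hu_sol.mono fun ω h => h.equation t v⟩,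
    fun w hw => ?_, fun t D hD => ?_⟩
  · filter_upwards [hu_sol, hw.ae_isPathwiseSolution] with ω h1 h2
    exact h2.unique hi hA hT h1
  · -- by causality, `y ↦ y t` is constant on the fibres of `F t`, hence a Borel function of `F t`
    have heval : Measurable fun y : C(Icc (0 : ℝ) T, StrongDual ℝ U) => y t :=
      (continuous_eval_const t).measurable
    obtain ⟨D', hD', hFD'⟩ := exists_measurableSet_preimage_eq (hF t)
      (heval.comp measurable_subtype_coe hD) fun y₁ y₂ h hy => by
        rw [mem_preimage, Function.comp_apply] at hy ⊢
        rwa [← hF_det h le_rfl]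
    refine measurableSet_augmentedFiltration_of_ae_eq hV
      ((heval.comp PathSpace.continuous_path.measurable).comp hu hD)
      (D' := {ω | sample q t (V ω) ∈ D'}) ?_ ?_
    · have hm : Measurable[augmentedFiltration P V hV t] fun ω => sample q t (V ω) :=
        @measurable_pi_lambda _ _ _ (augmentedFiltration P V hV t) _ _
          fun n => measurable_augmentedFiltration_eval hV (min_le_right (q n) t)
      exact hm hD'
    · filter_upwards [hu_sol] with ω hω
      have h : signalSample B q t (u ω).path ∈ D' ↔ (u ω).path t ∈ D :=
        Set.ext_iff.1 hFD' ⟨_, hmem_M _ (hgS _) _ hω⟩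
      rw [hω.signalSample_eq hBA] at h
      exact propext h.symm
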